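/- Let $\mathcal{A}$ be an abelian category of finite global dimension (there is an $n$ such that $\operatorname{Ext}^i_{\mathcal{A}}(X,Y)=0$ for all $i\ge n$ and all objects $X,Y$ of $\mathcal{A}$) in which countable coproducts exist and are exact. Let $\mathcal{U}\subset\mathcal{A}$ be a non-empty full subcategory closed under subobjects, quotients and extensions; in particular, $\mathcal{U}$ is an abelian category, and its inclusion into $\mathcal{A}$ is exact. Assume that for every epimorphism $p\colon A\to U$ in $\mathcal{A}$ with $U\in\mathcal{U}$ there is a subobject $V\subset A$ with $V\in\mathcal{U}$ such that the composition $V\hookrightarrow A\xrightarrow{p} U$ is an epimorphism. Let $D(\mathcal{U})$ and $D(\mathcal{A})$ denote the unbounded derived categories, and let $D_{\mathcal{U}}(\mathcal{A})\subset D(\mathcal{A})$ be the full subcategory of all complexes whose cohomology objects all lie in $\mathcal{U}$. Then the triangulated functor $D(\mathcal{U})\to D_{\mathcal{U}}(\mathcal{A})$ induced by the inclusion $\mathcal{U}\subset\mathcal{A}$ is an equivalence. -/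

import Mathlib

open CategoryTheory Limits ZeroObject

universe w w' v u

namespace SerreDerived

section Subcategory

variable {A : Type u} [Category.{v} A] [Abelian A] (P : ObjectProperty A)

/-- A non-empty class of objects that is closed under subobjects, quotients and extensions
is a Serre class in the sense of Mathlib: it contains the zero object, as a quotient of any
of its members. -/
instance isSerreClass_of_nonempty [P.Nonempty] [P.IsClosedUnderSubobjects]
    [P.IsClosedUnderQuotients] [P.IsClosedUnderExtensions] : P.IsSerreClass where
  exists_zero := by
    obtain ⟨X, hX⟩ := P.exists_prop_of_nonempty
    exact ⟨_, isZero_zero A, P.prop_of_epi (0 : X ⟶ 0) hX⟩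

instance isClosedUnderBinaryProducts [P.IsSerreClass] : P.IsClosedUnderBinaryProducts where
  limitsOfShape_le := by
    rintro X ⟨p⟩
    let e : X ≅ p.diag.obj (.mk .left) ⊞ p.diag.obj (.mk .right) :=
      IsLimit.conePointUniqueUpToIso
        ((IsLimit.postcomposeHomEquiv (diagramIsoPair p.diag) _).2 p.isLimit)
        (BinaryBiproduct.isLimit _ _)
    exact P.prop_of_iso e.symm (P.prop_X₂_of_exact
      (ShortComplex.Splitting.ofHasBinaryBiproduct _ _).exact
      (p.prop_diag_obj (.mk .left)) (p.prop_diag_obj (.mk .right)))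

instance isClosedUnderFiniteProducts [P.IsSerreClass] : P.IsClosedUnderFiniteProducts := .mk'

/-- The inclusion of a Serre subcategory is left exact. -/
instance preservesFiniteLimits_ι [P.IsSerreClass] : PreservesFiniteLimits P.ι :=
  have := P.preservesKernels_ι
  P.ι.preservesFiniteLimits_of_preservesKernels

/-- The inclusion of a Serre subcategory is right exact. -/
instance preservesFiniteColimits_ι [P.IsSerreClass] : PreservesFiniteColimits P.ι :=
  have := P.preservesCokernels_ι
  P.ι.preservesFiniteColimits_of_preservesCokernels

end Subcategory

/-- An abelian category has finite global dimension if there is `n` such that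
`Ext^i(X, Y) = 0` for all `i ≥ n` and all objects `X`, `Y`. -/
def HasFiniteGlobalDimension (A : Type u) [Category.{v} A] [Abelian A] : Prop :=
  ∃ n : ℕ, ∀ X : A, HasProjectiveDimensionLT X n

section Derived

variable {A : Type u} [Category.{v} A] [Abelian A] [HasDerivedCategory.{w} A]
  (P : ObjectProperty A)

/-- The objects of `D(A)` all of whose cohomology objects satisfy `P`. The corresponding full
subcategory is `D_P(A)`. -/
def cohomologyIn : ObjectProperty (DerivedCategory A) :=
  fun K ↦ ∀ n : ℤ, P ((DerivedCategory.homologyFunctor A n).obj K)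

/-- For a Serre class `P`, the full subcategory `D_P(A)` of `D(A)` is triangulated. -/
instance cohomologyIn_isTriangulated [P.IsSerreClass] : (cohomologyIn P).IsTriangulated where
  exists_zero := ⟨0, isZero_zero _, fun n ↦
    P.prop_of_isZero ((DerivedCategory.homologyFunctor A n).map_isZero (isZero_zero _))⟩
  isStableUnderShiftBy a :=
    { le_shift := fun K hK n ↦ P.prop_of_iso
        (((DerivedCategory.homologyFunctor A 0).shiftIso a n (a + n) rfl).symm.app K)
        (hK (a + n)) }
  ext₂' T hT h₁ h₃ := ⟨T.obj₂, fun n ↦ P.prop_X₂_of_exact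
    (DerivedCategory.HomologySequence.exact₂ T hT n) (h₁ n) (h₃ n), ⟨Iso.refl _⟩⟩

variable [P.IsSerreClass] [HasDerivedCategory.{w'} P.FullSubcategory]

/-- The functor `D(P) ⥤ D(A)` induced by the exact inclusion takes values in `D_P(A)`. -/
lemma cohomologyIn_mapDerivedCategory (K : DerivedCategory P.FullSubcategory) :
    cohomologyIn P (P.ι.mapDerivedCategory.obj K) := by
  intro n
  let L := DerivedCategory.Q.objPreimage K
  let e : (DerivedCategory.homologyFunctor A n).obj (P.ι.mapDerivedCategory.obj K) ≅
      P.ι.obj (L.homology n) :=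
    (DerivedCategory.homologyFunctor A n).mapIso
      (P.ι.mapDerivedCategory.mapIso (DerivedCategory.Q.objObjPreimageIso K).symm ≪≫
        P.ι.mapDerivedCategoryFactors.app L) ≪≫
      (DerivedCategory.homologyFunctorFactors A n).app _ ≪≫
      (L.sc n).mapHomologyIso P.ι
  exact P.prop_of_iso e.symm (L.homology n).property

/-- The functor `D(P) ⥤ D_P(A)` induced by the exact inclusion of the Serre subcategory given
by `P` into `A`. -/
noncomputable def derivedComparison :
    DerivedCategory P.FullSubcategory ⥤ (cohomologyIn (A := A) P).FullSubcategory :=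
  (cohomologyIn P).lift P.ι.mapDerivedCategory (cohomologyIn_mapDerivedCategory P)

/-- The comparison functor commutes with shifts, since the functor `D(P) ⥤ D(A)` does. -/
noncomputable instance derivedComparisonCommShift : (derivedComparison (A := A) P).CommShift ℤ :=
  inferInstanceAs (((cohomologyIn (A := A) P).lift P.ι.mapDerivedCategory
    (cohomologyIn_mapDerivedCategory P)).CommShift ℤ)

end Derived

end SerreDerived

/-! The core is that every complex `K` over `A` with cohomology in the Serre class `P` receives a
quasi-isomorphism from a complex with terms in `P` (`LiftsEpis.exists_quasiIso`). It is built by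
killing the cohomology of the cone of some `f : L ⟶ K`: given a morphism from `N` to this cone, a
shift of `N` can be attached to `L`, and the new cone is that of the given morphism
(`exists_attach`).

Lifting epimorphisms onto cohomology supplies objects of `P` to attach, but attaching one in degree
`n` may create cohomology of the cone in degree `n - 1`. Working downwards from `p` thus settles all
degrees `≤ p`. To then raise `p`, each correction would need a tail infinite to the left, and the
terms need not stabilise. Finite global dimension cuts the tail off: cohomology objects in distant
degrees split (`exists_hom_from_top_cohomology`), so corrections of uniformly bounded length exist
(`LiftsEpis.exists_bounded_resolution`) and the colimit is eventually constant in each degree.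

Resolving the middle term of a roof makes `D(P) ⥤ D(A)` full, and resolving an object of `D_P(A)`
puts it in the essential image. The functor also reflects isomorphisms, and a full triangulated
functor with this property is faithful. -/

namespace CochainComplex

/-! ### Mapping cones and attaching a complex along a map to the cone. -/

open HomologicalComplex HomComplex Pretriangulated

variable {A : Type u} [Category.{v} A] [Abelian A]

/-- The condition on `f` which is equivalent to the vanishing of the cohomology of its mapping
cone in degree `i`. -/
def ConeExactAt {L K : CochainComplex A ℤ} (f : L ⟶ K) (i : ℤ) : Prop :=
  Epi (homologyMap f i) ∧ Mono (homologyMap f (i + 1))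

lemma isZero_homology_mappingCone_iff {L K : CochainComplex A ℤ} (f : L ⟶ K) (i : ℤ) :
    IsZero ((mappingCone f).homology i) ↔ ConeExactAt f i := by
  let := HasDerivedCategory.standard A
  have hT := DerivedCategory.mappingCone_triangle_distinguished f
  have h₂ := homologyMap_exact₂_of_distTriang _ hT i
  have h₃ := homologyMap_exact₃_of_distTriang _ hT i (i + 1)
  have h₁ := homologyMap_exact₁_of_distTriang _ hT i (i + 1)
  constructor
  · intro h
    exact ⟨h₂.epi_f (h.eq_of_tgt _ _), h₁.mono_g (h.eq_of_src _ _)⟩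
  · rintro ⟨h, h'⟩
    refine h₃.isZero_of_both_zeros ?_ ?_
    · exact h₂.epi_f_iff.1 h
    · exact h₁.mono_g_iff.1 h'

lemma distinguished_Q_mappingConeCompTriangle [HasDerivedCategory.{w} A]
    {L L' K : CochainComplex A ℤ} (j : L ⟶ L') (f : L' ⟶ K) :
    DerivedCategory.Q.mapTriangle.obj (mappingConeCompTriangle j f) ∈ distTriang _ := by
  refine isomorphic_distinguished _ (DerivedCategory.Qh.map_distinguished _
    (HomotopyCategory.mappingConeCompTriangleh_distinguished j f)) _ ?_
  exact (Functor.mapTriangleIso (DerivedCategory.quotientCompQhIso A)).symm.app _ ≪≫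
    (Functor.mapTriangleCompIso (HomotopyCategory.quotient A _) DerivedCategory.Qh).app _

/-- By the octahedral axiom, the cone of `f'` is a cone of the map from the cone of `j` to the cone
of `f`; `e` replaces the source of that map by `N`. -/
lemma coneExactAt_of_comp {L L' K N : CochainComplex A ℤ} (j : L ⟶ L') (f' : L' ⟶ K)
    (f : L ⟶ K) (h : j ≫ f' = f) (e : N ⟶ mappingCone j) [QuasiIso e]
    (φ : N ⟶ mappingCone f)
    (hφ : e ≫ mappingCone.map j f (𝟙 _) f' (by simp [h]) = φ) (i : ℤ)
    (h₀ : Epi (homologyMap φ i)) (h₁ : Mono (homologyMap φ (i + 1))) :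
    ConeExactAt f' i := by
  subst h hφ
  let := HasDerivedCategory.standard A
  have hT := distinguished_Q_mappingConeCompTriangle j f'
  have h₂ := homologyMap_exact₂_of_distTriang _ hT i
  have h₃ := homologyMap_exact₃_of_distTriang _ hT i (i + 1)
  have h₁' := homologyMap_exact₁_of_distTriang _ hT i (i + 1)
  rw [← isZero_homology_mappingCone_iff]
  rw [homologyMap_comp] at h₀ h₁
  have h₀' : Epi (homologyMap (mappingConeCompTriangle j f').mor₁ i) :=
    @epi_of_epi _ _ _ _ _ (homologyMap e i) _ h₀
  have h₁'' : Mono (homologyMap (mappingConeCompTriangle j f').mor₁ (i + 1)) := by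
    have := (mono_comp_iff_of_isIso (homologyMap e (i + 1)) _).1 h₁
    exact this
  exact h₃.isZero_of_both_zeros (h₂.epi_f_iff.1 h₀') (h₁'.mono_g_iff.1 h₁'')

/-- A map from `M⟦1⟧` to the cone of `f` amounts to a map `ψ : M ⟶ L` with a null-homotopy of `ψ ≫
f`, which is what extends `f` to the cone of `ψ`. -/
lemma exists_attach_shift {L K M : CochainComplex A ℤ} (f : L ⟶ K) (φ : M⟦(1 : ℤ)⟧ ⟶ mappingCone f) :
    ∃ (ψ : M ⟶ L) (f' : mappingCone ψ ⟶ K), mappingCone.inr ψ ≫ f' = f ∧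
      ∀ i, Epi (homologyMap φ i) → Mono (homologyMap φ (i + 1)) → ConeExactAt f' i := by
  -- The signs here and in `c` make the rotation equivalence followed by the induced map of cones
  -- equal to `φ` itself.
  let z : Cocycle M (mappingCone f) (-1) := -(Cocycle.ofHom φ).leftUnshift (-1) (by lia)
  let c : Cocycle M L 0 := Cocycle.mk (-z.1.comp (mappingCone.fst f).1 (by lia)) 1 (by lia) (by
    simp [δ_comp _ _ (show (-1 : ℤ) + 1 = 0 by lia) 0 2 1 (by lia) (by lia) (by lia)])
  let ψ : M ⟶ L := c.homOf
  have hψ : Cochain.ofHom ψ = -z.1.comp (mappingCone.fst f).1 (by lia) := by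
    simp [ψ, c]
  let β : Cochain M K (-1) := z.1.comp (mappingCone.snd f) (by lia)
  have hβ : δ (-1) 0 β = Cochain.ofHom (ψ ≫ f) := by
    simp [β, hψ, δ_comp_zero_cochain]
  let f' := mappingCone.desc ψ β f hβ
  refine ⟨ψ, f', by simp [f'], ?_⟩
  have : QuasiIso (mappingCone.rotateHomotopyEquiv ψ).hom := inferInstance
  refine coneExactAt_of_comp (mappingCone.inr ψ) f' f (by simp [f'])
    (mappingCone.rotateHomotopyEquiv ψ).hom φ ?_
  ext n
  obtain ⟨φn, hφn⟩ : ∃ φn : M.X (n + 1) ⟶ (mappingCone f).X n, φn = φ.f n := ⟨φ.f n, rfl⟩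
  have hz : z.1.v (n + 1) n (by lia) = -φn := by
    have : z.1.v (n + 1) n (by lia) = -(𝟙 (M.X (n + 1)) ≫ φn) := by
      rw [hφn]
      simp [z, Cochain.leftUnshift_v (Cochain.ofHom φ) (-1) (by lia) (n + 1) n (by lia) n (by lia)]
      rfl
    rw [this, Category.id_comp]
  have hψn : ψ.f (n + 1) = φn ≫ (mappingCone.fst f).1.v n (n + 1) rfl := by
    have := Cochain.congr_v hψ (n + 1) (n + 1) (by lia)
    rw [Cochain.ofHom_v, Cochain.neg_v, Cochain.comp_v _ _ _ (n + 1) n (n + 1) (by lia) rfl,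
      hz, Preadditive.neg_comp, neg_neg] at this
    exact this
  have hβn : β.v (n + 1) n (by lia) = -(φn ≫ (mappingCone.snd f).v n n (by lia)) := by
    simp [β, hz]
  have h₁ : (mappingCone.rotateHomotopyEquiv ψ).hom.f n =
      ψ.f (n + 1) ≫ (mappingCone.inl (mappingCone.inr ψ)).v (n + 1) n (by lia) -
        (mappingCone.inl ψ).v (n + 1) n (by lia) ≫ (mappingCone.inr (mappingCone.inr ψ)).f n := by
    simp [mappingCone.rotateHomotopyEquiv, mappingCone.lift_f _ _ _ _ _ (n + 1) rfl,
      Cochain.leftShift_v (Cochain.ofHom ψ) 1 1 (by lia) n (n + 1) rfl (n + 1) (by lia),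
      Cochain.leftShift_v (mappingCone.inl ψ) 1 0 (by lia) n n (by lia) (n + 1) (by lia)]
    have key : ∀ {X Y Z W : A} (a : X ⟶ Y) (b : Y ⟶ W) (c : X ⟶ Z) (d : Z ⟶ W),
        (- -(𝟙 X ≫ a)) ≫ b + (-(𝟙 X ≫ c)) ≫ d = a ≫ b - c ≫ d := by simp [sub_eq_add_neg]
    exact key _ _ _ _
  rw [HomologicalComplex.comp_f, h₁, ← hφn]
  have h₂ : (ψ.f (n + 1) ≫ (mappingCone.inl (mappingCone.inr ψ)).v (n + 1) n (by lia) -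
      (mappingCone.inl ψ).v (n + 1) n (by lia) ≫ (mappingCone.inr (mappingCone.inr ψ)).f n) ≫
      (mappingCone.map (mappingCone.inr ψ) f (𝟙 L) f' (by simp [f'])).f n = φn := by
    rw [mappingCone.ext_to_iff _ n (n + 1) rfl]
    simp [mappingCone.map, f', hψn, hβn]
  exact h₂

end CochainComplex

/-! ### Attaching objects of the Serre class. -/

namespace CochainComplex

open HomologicalComplex HomComplex Pretriangulated

variable {A : Type u} [Category.{v} A] [Abelian A]

lemma isIso_inr_f_of_isZero {M L : CochainComplex A ℤ} (ψ : M ⟶ L) (i : ℤ)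
    (h : IsZero (M.X (i + 1))) : IsIso ((mappingCone.inr ψ).f i) := by
  refine ⟨(mappingCone.snd ψ).v i i (by lia), by simp, ?_⟩
  have := mappingCone.id_X ψ i (i + 1) rfl
  rwa [h.eq_of_tgt ((mappingCone.fst ψ).1.v i (i + 1) rfl) 0, zero_comp, zero_add] at this

/-- Given `φ : N ⟶ mappingCone f`, the complex `N` can be attached to the source of `f`,
and the mapping cone of the extended morphism is a mapping cone of `φ`. -/
lemma exists_attach {L K N : CochainComplex A ℤ} (f : L ⟶ K) (φ : N ⟶ mappingCone f) :
    ∃ (L' : CochainComplex A ℤ) (j : L ⟶ L') (f' : L' ⟶ K), j ≫ f' = f ∧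
      (∀ i, Nonempty (L'.X i ≅ N.X i ⊞ L.X i)) ∧
      (∀ i, IsZero (N.X i) → IsIso (j.f i)) ∧
      ∀ i, Epi (homologyMap φ i) → Mono (homologyMap φ (i + 1)) → ConeExactAt f' i := by
  let e : N⟦(-1 : ℤ)⟧⟦(1 : ℤ)⟧ ≅ N := shiftNegShift N (1 : ℤ)
  obtain ⟨ψ, f', fac, hf'⟩ := exists_attach_shift f (e.hom ≫ φ)
  have eX (i : ℤ) : (N⟦(-1 : ℤ)⟧).X (i + 1) ≅ N.X i := N.shiftFunctorObjXIso _ _ _ (by lia)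
  refine ⟨mappingCone ψ, mappingCone.inr ψ, f', fac, fun i ↦ ⟨?_⟩, fun i hi ↦ ?_, fun i h₀ h₁ ↦ ?_⟩
  · exact homotopyCofiber.XIsoBiprod ψ i (i + 1) rfl ≪≫ biprod.mapIso (eX i) (Iso.refl _)
  · exact isIso_inr_f_of_isZero ψ i (hi.of_iso (eX i))
  · apply hf'
    · rw [homologyMap_comp]; infer_instance
    · rw [homologyMap_comp]; infer_instance

variable (P : ObjectProperty A)

/-- The cochain complexes all of whose terms satisfy `P`. -/
def TermsIn : ObjectProperty (CochainComplex A ℤ) := fun L ↦ ∀ i, P (L.X i)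

/-- The cochain complexes all of whose cohomology objects satisfy `P`. -/
def HomologyIn : ObjectProperty (CochainComplex A ℤ) := fun L ↦ ∀ i, P (L.homology i)

/-- Any epimorphism onto an object satisfying `P` stays an epimorphism on a suitable subobject
satisfying `P`. -/
def LiftsEpis : Prop :=
  ∀ ⦃X Y : A⦄ (p : X ⟶ Y) [Epi p], P Y → ∃ V : Subobject X, P (V : A) ∧ Epi (V.arrow ≫ p)

variable {P}

/-- Lifting is applied to the projection from cycles to cohomology; a subobject of the cycles is a
map from a complex concentrated in degree `n`. -/
lemma LiftsEpis.exists_single (hP : LiftsEpis P) {C : CochainComplex A ℤ} (n : ℤ)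
    (hC : P (C.homology n)) :
    ∃ (V : A) (φ : (single A (.up ℤ) n).obj V ⟶ C), P V ∧ Epi (homologyMap φ n) := by
  obtain ⟨V, hV, _⟩ := hP (C.homologyπ n) hC
  let φ : (single A (.up ℤ) n).obj (V : A) ⟶ C :=
    mkHomFromSingle (V.arrow ≫ C.iCycles n) (by simp)
  refine ⟨V, φ, hV, ?_⟩
  have h₁ : (singleObjCyclesSelfIso _ _ _).inv ≫ cyclesMap φ n = V.arrow := by
    rw [← cancel_mono (C.iCycles n)]
    simp [φ]
  have h₂ : (singleObjHomologySelfIso _ _ _).inv ≫ homologyMap φ n =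
      V.arrow ≫ C.homologyπ n := by
    rw [← h₁, Category.assoc, ← homologyπ_naturality, singleObjCyclesSelfIso_inv_homologyπ_assoc]
  have : Epi ((singleObjHomologySelfIso _ _ _).inv ≫ homologyMap φ n) := by rwa [h₂]
  exact (epi_comp_iff_of_epi _ _).1 this

variable [P.IsSerreClass]

lemma TermsIn.homologyIn {L : CochainComplex A ℤ} (h : TermsIn P L) : HomologyIn P L :=
  fun i ↦ P.prop_of_epi (L.homologyπ i) (P.prop_of_mono (L.iCycles i) (h i))

lemma HomologyIn.mappingCone {L K : CochainComplex A ℤ} (f : L ⟶ K) (hL : HomologyIn P L)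
    (hK : HomologyIn P K) : HomologyIn P (mappingCone f) := by
  intro i
  let := HasDerivedCategory.standard A
  exact P.prop_X₂_of_exact (homologyMap_exact₃_of_distTriang _
    (DerivedCategory.mappingCone_triangle_distinguished f) i (i + 1)) (hK i) (hL (i + 1))

lemma prop_biprod {X Y : A} (hX : P X) (hY : P Y) : P (X ⊞ Y) :=
  P.prop_X₂_of_exact (ShortComplex.Splitting.ofHasBinaryBiproduct _ _).exact hX hY

/-- Nothing is claimed below degree `n`: the kernel of the map from the attached object to the
cohomology of the cone may contribute in degree `n - 1`. -/
lemma LiftsEpis.exists_attach_single (hP : LiftsEpis P) {L K : CochainComplex A ℤ} (f : L ⟶ K)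
    (hL : TermsIn P L) (hK : HomologyIn P K) (n : ℤ) :
    ∃ (L' : CochainComplex A ℤ) (j : L ⟶ L') (f' : L' ⟶ K), j ≫ f' = f ∧ TermsIn P L' ∧
      (∀ i, i ≠ n → IsIso (j.f i)) ∧ ConeExactAt f' n ∧
      ∀ i, n < i → ConeExactAt f i → ConeExactAt f' i := by
  obtain ⟨V, φ, hV, hφ⟩ := hP.exists_single n (hL.homologyIn.mappingCone f hK n)
  obtain ⟨L', j, f', fac, e, hj, hf'⟩ := exists_attach f φ
  have h₀ (i : ℤ) (hi : i ≠ n) := isZero_single_obj_X (.up ℤ) n V i hi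
  have h₁ (i : ℤ) (hi : i ≠ n) := isZero_single_obj_homology (.up ℤ) n V i hi
  refine ⟨L', j, f', fac, fun i ↦ ?_, fun i hi ↦ hj i (h₀ i hi),
    hf' n hφ ((h₁ _ (by lia)).mono _), fun i hi hi' ↦ ?_⟩
  · refine P.prop_of_iso (e i).some.symm (prop_biprod ?_ (hL i))
    by_cases hi : i = n
    · exact P.prop_of_iso (singleObjXIsoOfEq (.up ℤ) n V i hi).symm hV
    · exact P.prop_of_isZero (h₀ i hi)
  · rw [← isZero_homology_mappingCone_iff] at hi'
    exact hf' i (hi'.epi _) ((h₁ _ (by lia)).mono _)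

end CochainComplex

/-! ### Sequences of complexes over `K` and their colimits. -/

namespace CategoryTheory

lemma exists_functor_of_forall_exists_hom {C : Type u} [Category.{v} C] (Q : ℕ → C → Prop)
    (R : ℕ → ∀ ⦃X Y : C⦄, (X ⟶ Y) → Prop) {X₀ : C} (h₀ : Q 0 X₀)
    (h : ∀ n X, Q n X → ∃ (Y : C) (g : X ⟶ Y), Q (n + 1) Y ∧ R n g) :
    ∃ F : ℕ ⥤ C, (∀ n, Q n (F.obj n)) ∧ ∀ n, R n (F.map (homOfLE n.le_succ)) := by
  choose! Y g hY hg using h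
  let X (n : ℕ) : { X : C // Q n X } :=
    Nat.rec ⟨X₀, h₀⟩ (fun n X ↦ ⟨Y n X.1, hY n X.1 X.2⟩) n
  let G (n : ℕ) : (X n).1 ⟶ (X (n + 1)).1 := g n (X n).1 (X n).2
  refine ⟨Functor.ofSequence G, fun n ↦ (X n).2, fun n ↦ ?_⟩
  rw [Functor.ofSequence_map_homOfLE_succ]
  exact hg n (X n).1 (X n).2

end CategoryTheory

namespace CochainComplex

open HomologicalComplex

variable {A : Type u} [Category.{v} A] [Abelian A]

lemma coneExactAt_comp_iff_of_isIso {L L' K : CochainComplex A ℤ} (j : L ⟶ L') (f : L' ⟶ K)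
    (i : ℤ) [IsIso (homologyMap j i)] [IsIso (homologyMap j (i + 1))] :
    ConeExactAt (j ≫ f) i ↔ ConeExactAt f i := by
  simp only [ConeExactAt, homologyMap_comp, epi_comp_iff_of_epi, mono_comp_iff_of_isIso]

lemma isIso_homologyMap_of_isIso_f {L L' : CochainComplex A ℤ} (j : L ⟶ L') (i : ℤ)
    (h₀ : IsIso (j.f (i - 1))) (h₁ : IsIso (j.f i)) (h₂ : IsIso (j.f (i + 1))) :
    IsIso (homologyMap j i) := by
  rw [← quasiIsoAt_iff_isIso_homologyMap, quasiIsoAt_iff' _ (i - 1) i (i + 1) (by simp) (by simp)]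
  let φ := (shortComplexFunctor' A (.up ℤ) (i - 1) i (i + 1)).map j
  have : IsIso φ.τ₁ := h₀
  have : IsIso φ.τ₂ := h₁
  have : IsIso φ.τ₃ := h₂
  exact ShortComplex.quasiIso_of_epi_of_isIso_of_mono φ

/-- Each degree is eventually constant, so the colimit exists degreewise and its cohomology in a
given degree is that of a late enough stage. -/
lemma exists_colimit_over {K : CochainComplex A ℤ} (F : ℕ ⥤ Over K)
    (hF : ∀ i, ∃ N : ℕ, ∀ n : ℕ, N ≤ n → IsIso ((F.map (homOfLE n.le_succ)).left.f i)) :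
    ∃ (L : CochainComplex A ℤ) (f : L ⟶ K),
      (∀ i, ∃ n, Nonempty (L.X i ≅ (F.obj n).left.X i)) ∧
      ∀ i, (∃ N, ∀ n, N ≤ n → ConeExactAt (F.obj n).hom i) → ConeExactAt f i := by
  let G := F ⋙ Over.forget K
  choose N hN using hF
  have hG (i : ℤ) : (G ⋙ eval A (.up ℤ) i).IsEventuallyConstantFrom (N i) := by
    intro n g
    obtain ⟨k, rfl⟩ := Nat.exists_eq_add_of_le (leOfHom g)
    obtain rfl : g = homOfLE (by lia) := Subsingleton.elim _ _
    induction k with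
    | zero => exact inferInstanceAs (IsIso ((G ⋙ eval A (.up ℤ) i).map (𝟙 _)))
    | succ k hk =>
      have h₁ := hk
      have h₂ := hN i (N i + k) (by lia)
      have : homOfLE (show N i ≤ N i + (k + 1) by lia) =
        homOfLE (show N i ≤ N i + k by lia) ≫ homOfLE (Nat.le_succ _) := rfl
      rw [this, Functor.map_comp]
      exact IsIso.comp_isIso' h₁ h₂
  have (i : ℤ) : HasColimit (G ⋙ eval A (.up ℤ) i) := (hG i).hasColimit
  let f : colimit G ⟶ K := colimit.desc G ⟨K, { app n := (F.obj n).hom }⟩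
  have hι (i : ℤ) (n : ℕ) (hn : N i ≤ n) : IsIso ((colimit.ι G n).f i) :=
    (hG i).isIso_ι_of_isColimit' (isColimitOfPreserves (eval A (.up ℤ) i) (colimit.isColimit G))
      n (homOfLE hn)
  refine ⟨colimit G, f, fun i ↦ ⟨N i, ?_⟩, ?_⟩
  · have := hι i (N i) le_rfl
    exact ⟨(asIso ((colimit.ι G (N i)).f i)).symm⟩
  · rintro i ⟨M, hM⟩
    -- Exactness of the cone at `i` involves cohomology in degrees `i` and `i + 1`, hence terms from
    -- `i - 1` to `i + 2`.
    let n := M + N (i - 1) + N i + N (i + 1) + N (i + 1 + 1)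
    have hf : colimit.ι G n ≫ f = (F.obj n).hom := colimit.ι_desc _ _
    have := isIso_homologyMap_of_isIso_f (colimit.ι G n) i (hι _ _ (by lia)) (hι _ _ (by lia))
      (hι _ _ (by lia))
    have := isIso_homologyMap_of_isIso_f (colimit.ι G n) (i + 1)
      (by rw [add_sub_cancel_right]; exact hι _ _ (by lia)) (hι _ _ (by lia)) (hι _ _ (by lia))
    rw [← coneExactAt_comp_iff_of_isIso (colimit.ι G n) f i, hf]
    exact hM n (by lia)

end CochainComplex

/-! ### Splitting off the top cohomology, and resolutions bounded above. -/

namespace CochainComplex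

open HomologicalComplex Pretriangulated

variable {A : Type u} [Category.{v} A] [Abelian A]

/-- After shifting, this is `Ext` in degree `p + k - q ≥ n`. -/
lemma subsingleton_hom_singleFunctor [HasDerivedCategory.{w} A] (X Y : A) (n : ℕ)
    [HasProjectiveDimensionLT X n] (p q k : ℤ) (h : q + n ≤ p + k) :
    Subsingleton ((DerivedCategory.singleFunctor A p).obj X ⟶
      ((DerivedCategory.singleFunctor A q).obj Y)⟦k⟧) := by
  have := hasExt_of_hasDerivedCategory A
  obtain ⟨l, hl⟩ : ∃ l : ℕ, (l : ℤ) = p + k - q := ⟨(p + k - q).toNat, by lia⟩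
  have := HasProjectiveDimensionLT.subsingleton X n l (by lia) Y
  have h₀ : Subsingleton ((DerivedCategory.singleFunctor A 0).obj X ⟶
      ((DerivedCategory.singleFunctor A 0).obj Y)⟦(l : ℤ)⟧) :=
    (Abelian.Ext.homEquiv (X := X) (Y := Y) (n := l)).symm.subsingleton
  let S := DerivedCategory.singleFunctors A
  let e₁ : ((S.functor p).obj X)⟦p⟧ ≅ (S.functor 0).obj X := (S.shiftIso p 0 p (by lia)).app X
  let e₂ : (((S.functor q).obj Y)⟦k⟧)⟦p⟧ ≅ ((S.functor 0).obj Y)⟦(l : ℤ)⟧ :=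
    (CategoryTheory.shiftFunctorAdd' (DerivedCategory A) k p (k + p) rfl).symm.app _ ≪≫
      (S.shiftIso (k + p) (-l) q (by lia)).app Y ≪≫ ((S.shiftIso l (-l) 0 (by lia)).symm).app Y
  refine ⟨fun f g ↦ (CategoryTheory.shiftFunctor (DerivedCategory A) p).map_injective ?_⟩
  rw [← cancel_epi e₁.inv, ← cancel_mono e₂.hom]
  exact h₀.elim _ _

/-- The truncation triangle has outer terms concentrated in degrees `q` and `p`, so its connecting
morphism is an `Ext` class of degree `p + 1 - q ≥ n`. It vanishes, and the triangle splits. -/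
lemma exists_hom_from_top_cohomology (M : CochainComplex A ℤ) (p q : ℤ) (n : ℕ)
    (hn : ∀ X : A, HasProjectiveDimensionLT X n) (hpq : q < p) (hq : q + n ≤ p + 1)
    (hM : ∀ i, i ≠ p → i ≠ q → IsZero (M.homology i)) :
    ∃ (M' : CochainComplex A ℤ) (g : M' ⟶ M), (∀ i, i ≠ p → IsZero (M'.homology i)) ∧
      IsIso (homologyMap g p) := by
  let := HasDerivedCategory.standard A
  obtain ⟨X, Y, hX, hY, f, g, h, hT⟩ := DerivedCategory.TStructure.t.exists_triangle
    (DerivedCategory.Q.obj M) (p - 1) p (by lia)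
  have : X.IsLE (p - 1) := ⟨hX⟩
  have : Y.IsGE p := ⟨hY⟩
  let H := DerivedCategory.homologyFunctor A
  have eM (i : ℤ) : (H i).obj (DerivedCategory.Q.obj M) ≅ M.homology i :=
    (DerivedCategory.homologyFunctorFactors A i).app M
  have hMz (i : ℤ) (hi : i ≠ p) (hi' : i ≠ q) : IsZero ((H i).obj (DerivedCategory.Q.obj M)) :=
    (hM i hi hi').of_iso (eM i)
  have hXz (i : ℤ) (hi : p - 1 < i) : IsZero ((H i).obj X) := X.isZero_of_isLE (p - 1) i hi
  have hYz (i : ℤ) (hi : i < p) : IsZero ((H i).obj Y) := Y.isZero_of_isGE p i hi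
  have hYz' (i : ℤ) (hi : p < i) : IsZero ((H i).obj Y) :=
    (DerivedCategory.HomologySequence.exact₃ _ hT i (i + 1)).isZero_of_both_isZero
      (hMz i (by lia) (by lia)) (hXz _ (by lia))
  have hXz' (i : ℤ) (hi : i < p) (hi' : i ≠ q) : IsZero ((H i).obj X) :=
    (DerivedCategory.HomologySequence.exact₁ _ hT (i - 1) i).isZero_of_both_isZero
      (hYz _ (by lia)) (hMz i (by lia) hi')
  have : X.IsLE q := by
    rw [DerivedCategory.isLE_iff]
    intro i hi
    by_cases hi' : i < p
    · exact hXz' i hi' (by lia)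
    · exact hXz i (by lia)
  have : X.IsGE q := by
    rw [DerivedCategory.isGE_iff]
    exact fun i hi ↦ hXz' i (by lia) (by lia)
  have : Y.IsLE p := by
    rw [DerivedCategory.isLE_iff]
    exact hYz'
  obtain ⟨X₀, ⟨eX⟩⟩ := X.exists_iso_singleFunctor_obj_of_isGE_of_isLE q
  obtain ⟨Y₀, ⟨eY⟩⟩ := Y.exists_iso_singleFunctor_obj_of_isGE_of_isLE p
  have hh : h = 0 := by
    have := hn Y₀
    have := subsingleton_hom_singleFunctor Y₀ X₀ n p q 1 hq
    rw [← cancel_epi eY.inv, ← cancel_mono (eX.hom⟦(1 : ℤ)⟧')]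
    exact this.elim _ _
  obtain ⟨s, hs⟩ : ∃ s : Y ⟶ DerivedCategory.Q.obj M, 𝟙 Y = s ≫ g :=
    Triangle.coyoneda_exact₃ _ hT (𝟙 Y) (by rw [hh]; exact comp_zero)
  have hsp : IsIso ((H p).map s) := by
    have h₁ : (H p).map s ≫ (H p).map g = 𝟙 _ := by
      rw [← Functor.map_comp, ← hs]
      exact CategoryTheory.Functor.map_id _ _
    have h₂ : Mono ((H p).map g) :=
      (DerivedCategory.HomologySequence.mono_homologyMap_mor₂_iff _ hT p).2
        ((hXz p (by lia)).eq_of_src _ _)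
    exact ⟨(H p).map g, h₁, by rw [← cancel_mono ((H p).map g), Category.assoc, h₁]; simp⟩
  let e := DerivedCategory.Q.objObjPreimageIso Y
  -- A roof turns the section in the derived category into a morphism of complexes, at the price of
  -- replacing its source.
  obtain ⟨M', t, ht, g', fac⟩ := DerivedCategory.right_fac (e.hom ≫ s)
  have fac' : DerivedCategory.Q.map g' = (DerivedCategory.Q.map t ≫ e.hom) ≫ s := by
    rw [Category.assoc, fac, IsIso.hom_inv_id_assoc]
  let e' : DerivedCategory.Q.obj M' ≅ Y := asIso (DerivedCategory.Q.map t ≫ e.hom)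
  refine ⟨M', g', fun i hi ↦ ?_, ?_⟩
  · refine IsZero.of_iso ?_ ((DerivedCategory.homologyFunctorFactors A i).symm.app M' ≪≫
      (H i).mapIso e')
    obtain hi | hi := lt_or_gt_of_ne hi
    · exact hYz i hi
    · exact hYz' i hi
  · have : IsIso ((H p).map (DerivedCategory.Q.map g')) := by
      rw [fac', Functor.map_comp]
      infer_instance
    exact (NatIso.isIso_map_iff (DerivedCategory.homologyFunctorFactors A p) g').1 this

variable {P : ObjectProperty A} [P.IsSerreClass]

lemma LiftsEpis.exists_tower (hP : LiftsEpis P) {K : CochainComplex A ℤ} (hK : HomologyIn P K)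
    (p : ℤ) :
    ∃ F : ℕ ⥤ Over K, (∀ n, TermsIn P (F.obj n).left ∧
        (∀ i, p < i ∨ i ≤ p - n → IsZero ((F.obj n).left.X i)) ∧
        ∀ i, p - n < i → i ≤ p → ConeExactAt (F.obj n).hom i) ∧
      ∀ (n : ℕ) (i : ℤ), i ≠ p - n → IsIso ((F.map (homOfLE n.le_succ)).left.f i) := by
  refine exists_functor_of_forall_exists_hom
    (fun n (X : Over K) ↦ TermsIn P X.left ∧ (∀ i, p < i ∨ i ≤ p - n → IsZero (X.left.X i)) ∧
        ∀ i, p - n < i → i ≤ p → ConeExactAt X.hom i)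
    (fun n ⦃X Y : Over K⦄ (g : X ⟶ Y) ↦ ∀ i : ℤ, i ≠ p - n → IsIso (g.left.f i)) (X₀ := Over.mk (0 : 0 ⟶ K))
    ⟨fun i ↦ ?_, fun i hi ↦ ?_, fun i hi hi' ↦ by lia⟩ ?_
  · exact P.prop_of_isZero ((HomologicalComplex.eval A (.up ℤ) i).map_isZero (isZero_zero _))
  · exact (HomologicalComplex.eval A (.up ℤ) i).map_isZero (isZero_zero _)
  · rintro n X ⟨h₁, h₂, h₃⟩
    obtain ⟨L', j, f', fac, hL', hj, hf', hf''⟩ := hP.exists_attach_single X.hom h₁ hK (p - n)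
    refine ⟨Over.mk f', Over.homMk j fac, ⟨hL', fun i hi ↦ ?_, fun i hi hi' ↦ ?_⟩, hj⟩
    · have := hj i (by lia)
      exact (h₂ i (by lia)).of_iso (asIso (j.f i)).symm
    · obtain rfl | hi'' := eq_or_ne i (p - n)
      · exact hf'
      · exact hf'' i (by lia) (h₃ i (by lia) hi')

lemma LiftsEpis.exists_bounded (hP : LiftsEpis P) {K : CochainComplex A ℤ}
    (hK : HomologyIn P K) (q p : ℤ) (hqp : q ≤ p) :
    ∃ (L : CochainComplex A ℤ) (f : L ⟶ K), TermsIn P L ∧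
      (∀ i, p < i ∨ i < q → IsZero (L.X i)) ∧ ∀ i, q ≤ i → i ≤ p → ConeExactAt f i := by
  obtain ⟨F, hF, -⟩ := hP.exists_tower hK p
  -- At this stage `p - n = q - 1`.
  obtain ⟨h₁, h₂, h₃⟩ := hF (p + 1 - q).toNat
  exact ⟨_, (F.obj (p + 1 - q).toNat).hom, h₁, fun i hi ↦ h₂ i (by lia),
    fun i hi hi' ↦ h₃ i (by lia) hi'⟩

lemma LiftsEpis.exists_boundedAbove (hP : LiftsEpis P) {K : CochainComplex A ℤ}
    (hK : HomologyIn P K) (p : ℤ) :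
    ∃ (L : CochainComplex A ℤ) (f : L ⟶ K), TermsIn P L ∧
      (∀ i, p < i → IsZero (L.X i)) ∧ ∀ i, i ≤ p → ConeExactAt f i := by
  obtain ⟨F, hF, hF'⟩ := hP.exists_tower hK p
  obtain ⟨L, f, e, hf⟩ := exists_colimit_over F
    (fun i ↦ ⟨(p + 1 - i).toNat, fun n hn ↦ hF' n i (by lia)⟩)
  refine ⟨L, f, fun i ↦ ?_, fun i hi ↦ ?_, fun i hi ↦ hf i ⟨(p + 1 - i).toNat, fun n hn ↦ ?_⟩⟩
  · obtain ⟨n, ⟨e⟩⟩ := e i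
    exact P.prop_of_iso e.symm ((hF n).1 i)
  · obtain ⟨n, ⟨e⟩⟩ := e i
    exact ((hF n).2.1 i (by lia)).of_iso e
  · exact (hF n).2.2 i (by lia) hi

end CochainComplex

/-! ### Bounded corrections and the full resolution. -/

namespace CochainComplex

open HomologicalComplex Pretriangulated

variable {A : Type u} [Category.{v} A] [Abelian A]

lemma isIso_homologyMap_of_coneExactAt {L K : CochainComplex A ℤ} {f : L ⟶ K} {i : ℤ}
    (h₀ : ConeExactAt f (i - 1)) (h₁ : ConeExactAt f i) : IsIso (homologyMap f i) := by
  have := h₁.1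
  have h {j : ℤ} (hj : j + 1 = i) (hf : Mono (homologyMap f (j + 1))) : Mono (homologyMap f i) := by
    subst hj
    exact hf
  have := h (sub_add_cancel i 1) h₀.2
  exact isIso_of_mono_of_epi _

lemma isZero_homology_of_isZero_X {L : CochainComplex A ℤ} {i : ℤ} (h : IsZero (L.X i)) :
    IsZero (L.homology i) :=
  ShortComplex.isZero_homology_of_isZero_X₂ _ h

variable {P : ObjectProperty A} [P.IsSerreClass]

/-- A finite stage `M` of the downward construction has the right cohomology except for a spurious
group in its lowest degree. Splitting removes it but leaves `P`; resolving again restores terms in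
`P` but loses the lower bound; truncation, which takes quotients of terms, recovers the bound. -/
lemma LiftsEpis.exists_bounded_resolution (hP : LiftsEpis P) (n : ℕ)
    (hn : ∀ X : A, HasProjectiveDimensionLT X n) {C : CochainComplex A ℤ}
    (hC : HomologyIn P C) (p : ℤ) (hp : ∀ i, i < p → IsZero (C.homology i)) :
    ∃ (N : CochainComplex A ℤ) (φ : N ⟶ C), TermsIn P N ∧
      (∀ i, p < i ∨ i < p - n - 1 → IsZero (N.X i)) ∧
      (∀ i, i ≤ p → Epi (homologyMap φ i)) ∧ ∀ i, i ≤ p + 1 → Mono (homologyMap φ i) := by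
  -- The lowest degree is far enough from `p` for the `Ext` class to vanish, and lies below `p` even
  -- when `n = 0`.
  obtain ⟨M, f, hM, hM₀, hf⟩ := hP.exists_bounded hC (p - n - 1) p (by lia)
  have hfiso (i : ℤ) (hi : p - n - 1 < i) (hi' : i ≤ p) : IsIso (homologyMap f i) :=
    isIso_homologyMap_of_coneExactAt (hf _ (by lia) (by lia)) (hf i (by lia) hi')
  obtain ⟨M₁, g, hM₁, hg⟩ := exists_hom_from_top_cohomology M p (p - n - 1) n hn (by lia) (by lia)
    (fun i hi hi' ↦ by
      by_cases h : p - n - 1 < i ∧ i < p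
      · have := hfiso i h.1 (by lia)
        exact (hp i h.2).of_iso (asIso (homologyMap f i))
      · exact isZero_homology_of_isZero_X (hM₀ i (by lia)))
  have hM₁' : HomologyIn P M₁ := by
    intro i
    obtain rfl | hi := eq_or_ne i p
    · exact P.prop_of_iso (asIso (homologyMap g i)).symm (hM.homologyIn i)
    · exact P.prop_of_isZero (hM₁ i hi)
  obtain ⟨L, l, hL, hL₀, hl⟩ := hP.exists_boundedAbove hM₁' p
  have hl' (i : ℤ) (hi : i ≤ p) : IsIso (homologyMap l i) :=
    isIso_homologyMap_of_coneExactAt (hl _ (by lia)) (hl i hi)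
  have hL' (i : ℤ) (hi : i < p) : IsZero (L.homology i) := by
    have := hl' i hi.le
    exact (hM₁ i hi.ne).of_iso (asIso (homologyMap l i))
  have : L.IsGE (p - n - 1) := by
    rw [isGE_iff]
    exact fun i hi ↦ by
      rw [exactAt_iff_isZero_homology]
      exact hL' i (by lia)
  have : M.IsStrictlyGE (p - n - 1) := by
    rw [isStrictlyGE_iff]
    exact fun i hi ↦ hM₀ i (by lia)
  let π := L.πTruncGE (p - n - 1)
  have hπ (i : ℤ) : Epi (π.f i) :=
    inferInstanceAs (Epi ((HomologicalComplex.πTruncGE L (ComplexShape.embeddingUpIntGE (p - n - 1))).f i))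
  -- `M` already vanishes below the truncation degree, so its own truncation map is invertible.
  let φ := truncGEMap (l ≫ g) (p - n - 1) ≫ inv (M.πTruncGE (p - n - 1)) ≫ f
  have hφ : π ≫ φ = l ≫ g ≫ f := by simp [π, φ, πTruncGE_naturality_assoc]
  have hN (i : ℤ) (hi : i < p) : IsZero ((L.truncGE (p - n - 1)).homology i) :=
    (hL' i hi).of_iso (asIso (homologyMap π i)).symm
  have hN₀ (i : ℤ) (hi : p < i) : IsZero ((L.truncGE (p - n - 1)).X i) :=
    IsZero.of_epi (π.f i) (hL₀ i hi)
  have hφp : IsIso (homologyMap φ p) := by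
    have h₁ := hl' p le_rfl
    have h₂ := hfiso p (by lia) le_rfl
    have h₃ : homologyMap π p ≫ homologyMap φ p =
        homologyMap l p ≫ homologyMap g p ≫ homologyMap f p := by
      simp only [← homologyMap_comp, hφ]
    have h₄ : IsIso (homologyMap π p ≫ homologyMap φ p) := by rw [h₃]; infer_instance
    exact IsIso.of_isIso_comp_left (homologyMap π p) _
  refine ⟨L.truncGE (p - n - 1), φ, fun i ↦ P.prop_of_epi (π.f i) (hL i), ?_, fun i hi ↦ ?_,
    fun i hi ↦ ?_⟩
  · rintro i (hi | hi)
    · exact hN₀ i hi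
    · exact isZero_of_isStrictlyGE _ (p - n - 1) i hi
  · obtain rfl | hi := eq_or_lt_of_le hi
    · infer_instance
    · exact (hp i hi).epi _
  · obtain hi | rfl | hi := lt_trichotomy i p
    · exact (hN i hi).mono _
    · infer_instance
    · exact (isZero_homology_of_isZero_X (hN₀ i hi)).mono _

lemma LiftsEpis.exists_quasiIso (hP : LiftsEpis P) (d : ℕ)
    (hd : ∀ X : A, HasProjectiveDimensionLT X d) {K : CochainComplex A ℤ} (hK : HomologyIn P K) :
    ∃ (L : CochainComplex A ℤ) (f : L ⟶ K), TermsIn P L ∧ QuasiIso f := by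
  obtain ⟨L₀, f₀, hL₀, -, hf₀⟩ := hP.exists_boundedAbove hK 0
  obtain ⟨F, hF, hF'⟩ := exists_functor_of_forall_exists_hom
    (fun n (X : Over K) ↦ TermsIn P X.left ∧ ∀ i : ℤ, i ≤ n → ConeExactAt X.hom i)
    (fun n ⦃X Y : Over K⦄ (g : X ⟶ Y) ↦ ∀ i : ℤ, i < n - d → IsIso (g.left.f i))
    (X₀ := Over.mk f₀) ⟨hL₀, by simpa using hf₀⟩ (by
      rintro n X ⟨hX, hX'⟩
      -- The correction lives in degrees `n - d` to `n + 1`, so later stages never touch a given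
      -- degree again.
      obtain ⟨N, φ, hN, hN₀, hφ, hφ'⟩ := hP.exists_bounded_resolution d hd
        (hX.homologyIn.mappingCone X.hom hK) (n + 1)
        (fun i hi ↦ (isZero_homology_mappingCone_iff _ _).2 (hX' i (by lia)))
      obtain ⟨L', j, f', fac, e, hj, hf'⟩ := exists_attach X.hom φ
      refine ⟨Over.mk f', Over.homMk j fac, ⟨fun i ↦ ?_, fun i hi ↦ ?_⟩, fun i hi ↦ ?_⟩
      · exact P.prop_of_iso (e i).some.symm (prop_biprod (hN i) (hX i))
      · push_cast at hi
        exact hf' i (hφ i hi) (hφ' (i + 1) (by lia))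
      · exact hj i (hN₀ i (by lia)))
  obtain ⟨L, f, e, hf⟩ := exists_colimit_over F
    (fun i ↦ ⟨(i + d + 1).toNat, fun n hn ↦ hF' n i (by lia)⟩)
  have hf' (i : ℤ) : ConeExactAt f i := hf i ⟨i.toNat, fun n hn ↦ (hF n).2 i (by lia)⟩
  refine ⟨L, f, fun i ↦ ?_, ⟨fun i ↦ ?_⟩⟩
  · obtain ⟨n, ⟨e⟩⟩ := e i
    exact P.prop_of_iso e.symm ((hF n).1 i)
  · rw [quasiIsoAt_iff_isIso_homologyMap]
    exact isIso_homologyMap_of_coneExactAt (hf' _) (hf' _)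

end CochainComplex

/-! ### Faithfulness from fullness and reflection of isomorphisms. -/

namespace CategoryTheory

open Pretriangulated

/-- If `F.map f = 0`, the map `z` completing `f` to a triangle has a section after `F`. Fullness
lifts this to `s` with `s ≫ z` invertible, and `z ≫ f = 0` forces `f = 0`. -/
lemma Functor.faithful_of_full_of_reflectsIsomorphisms {C D : Type*} [Category* C] [Category* D]
    [HasZeroObject C] [HasZeroObject D] [Preadditive C] [Preadditive D] [HasShift C ℤ]
    [HasShift D ℤ] [∀ n : ℤ, (CategoryTheory.shiftFunctor C n).Additive]
    [∀ n : ℤ, (CategoryTheory.shiftFunctor D n).Additive] [Pretriangulated C] [Pretriangulated D]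
    (F : C ⥤ D) [F.CommShift ℤ] [F.IsTriangulated] [F.Full] [F.ReflectsIsomorphisms] :
    F.Faithful := by
  suffices ∀ {X Y : C} (f : X ⟶ Y), F.map f = 0 → f = 0 from
    ⟨fun {X Y f g} h ↦ sub_eq_zero.1 (this _ (by rw [F.map_sub, h, sub_self]))⟩
  intro X Y f hf
  obtain ⟨Z, z, h, hT⟩ := distinguished_cocone_triangle₁ f
  obtain ⟨s, hs⟩ : ∃ s : F.obj X ⟶ F.obj Z, 𝟙 (F.obj X) = s ≫ F.map z :=
    Triangle.coyoneda_exact₂ _ (F.map_distinguished _ hT) (𝟙 (F.obj X))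
      ((Category.id_comp _).trans hf)
  obtain ⟨s, rfl⟩ := F.map_surjective s
  have : IsIso (F.map (s ≫ z)) := by
    rw [F.map_comp, ← hs]
    infer_instance
  have := isIso_of_reflects_iso (s ≫ z) F
  have hz : z ≫ f = 0 := comp_distTriang_mor_zero₁₂ _ hT
  rw [← cancel_epi (s ≫ z), Category.assoc, hz, comp_zero, comp_zero]

end CategoryTheory

namespace CategoryTheory.Functor

variable {C D : Type*} [Category* C] [Category* D] [Abelian C] [Abelian D]
  [HasDerivedCategory.{w} C]
  (F : C ⥤ D) [F.Additive] [PreservesFiniteLimits F] [PreservesFiniteColimits F]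

lemma isIso_Q_map_of_quasiIso_map [F.ReflectsIsomorphisms] {K L : CochainComplex C ℤ} (f : K ⟶ L)
    (hf : QuasiIso ((F.mapHomologicalComplex (.up ℤ)).map f)) :
    IsIso (DerivedCategory.Q.map f) := by
  rw [DerivedCategory.isIso_Q_map_iff_quasiIso]
  exact (HomologicalComplex.quasiIso_map_iff_of_preservesHomology f F).1 hf

variable [HasDerivedCategory.{w'} D]

lemma isIso_mapDerivedCategory_map_Q_map_iff {K L : CochainComplex C ℤ} (f : K ⟶ L) :
    IsIso (F.mapDerivedCategory.map (DerivedCategory.Q.map f)) ↔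
      QuasiIso ((F.mapHomologicalComplex (.up ℤ)).map f) := by
  rw [← DerivedCategory.isIso_Q_map_iff_quasiIso]
  exact NatIso.isIso_map_iff F.mapDerivedCategoryFactors f

instance [F.ReflectsIsomorphisms] : F.mapDerivedCategory.ReflectsIsomorphisms where
  reflects {X Y} f hf := by
    let eX := DerivedCategory.Q.objObjPreimageIso X
    let eY := DerivedCategory.Q.objObjPreimageIso Y
    obtain ⟨Z, s, _, g, fac⟩ := DerivedCategory.right_fac (eX.hom ≫ f ≫ eY.inv)
    have hg : DerivedCategory.Q.map g = DerivedCategory.Q.map s ≫ eX.hom ≫ f ≫ eY.inv := by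
      rw [fac, IsIso.hom_inv_id_assoc]
    have : IsIso (F.mapDerivedCategory.map (DerivedCategory.Q.map g)) := by
      simp only [hg, Functor.map_comp]
      infer_instance
    rw [isIso_mapDerivedCategory_map_Q_map_iff] at this
    have := F.isIso_Q_map_of_quasiIso_map g this
    have hf : f = eX.inv ≫ CategoryTheory.inv (DerivedCategory.Q.map s) ≫
        DerivedCategory.Q.map g ≫ eY.hom := by
      simp [hg]
    rw [hf]
    infer_instance

end CategoryTheory.Functor

/-! ### The equivalence of derived categories. -/

namespace SerreDerived

open CochainComplex

lemma exists_quasiIso_from_full_subcategory {A : Type u} [Category.{v} A] [Abelian A]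
    {P : ObjectProperty A} [P.IsSerreClass] (hP : LiftsEpis P) (hA : HasFiniteGlobalDimension A)
    {K : CochainComplex A ℤ} (hK : HomologyIn P K) :
    ∃ (L : CochainComplex P.FullSubcategory ℤ)
      (f : (P.ι.mapHomologicalComplex (.up ℤ)).obj L ⟶ K), QuasiIso f := by
  obtain ⟨d, hd⟩ := hA
  obtain ⟨L, f, hL, hf⟩ := hP.exists_quasiIso d hd hK
  exact ⟨HomologicalComplex.liftObjectProperty P L hL, f, hf⟩

variable {A : Type u} [Category.{v} A] [Abelian A] [HasDerivedCategory.{w} A]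
  {P : ObjectProperty A} [P.IsSerreClass]

instance cohomologyIn_isClosedUnderIsomorphisms :
    (cohomologyIn (A := A) P).IsClosedUnderIsomorphisms where
  of_iso e h n := P.prop_of_iso ((DerivedCategory.homologyFunctor A n).mapIso e) (h n)

lemma homologyIn_iff_cohomologyIn_Q (K : CochainComplex A ℤ) :
    HomologyIn P K ↔ cohomologyIn P (DerivedCategory.Q.obj K) :=
  forall_congr' fun n ↦
    P.prop_iff_of_iso ((DerivedCategory.homologyFunctorFactors A n).symm.app K)

variable [HasDerivedCategory.{w'} P.FullSubcategory]

lemma mapDerivedCategory_full (hP : LiftsEpis P) (hA : HasFiniteGlobalDimension A) :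
     (P.ι.mapDerivedCategory : DerivedCategory P.FullSubcategory ⥤
    DerivedCategory A).Full where
  map_surjective {X Y} f := by
    let G := P.ι.mapHomologicalComplex (.up ℤ)
    let Φ : DerivedCategory P.FullSubcategory ⥤ DerivedCategory A := P.ι.mapDerivedCategory
    let eX := DerivedCategory.Q.objObjPreimageIso X
    let eY := DerivedCategory.Q.objObjPreimageIso Y
    let e : DerivedCategory.Q ⋙ Φ ≅ G ⋙ DerivedCategory.Q := P.ι.mapDerivedCategoryFactors
    obtain ⟨Z, s, _, t, fac⟩ := DerivedCategory.right_fac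
      (e.inv.app _ ≫ Φ.map eX.hom ≫ f ≫ Φ.map eY.inv ≫ e.hom.app _)
    have hZ : HomologyIn P Z := by
      rw [homologyIn_iff_cohomologyIn_Q]
      exact (cohomologyIn P).prop_of_iso (asIso (DerivedCategory.Q.map s)).symm
        ((homologyIn_iff_cohomologyIn_Q _).1 (TermsIn.homologyIn fun i ↦ ObjectProperty.FullSubcategory.property _))
    -- The middle term of the roof is quasi-isomorphic to a complex over `P`, hence has cohomology
    -- in `P`; once it is resolved, both legs come from the full subcategory.
    obtain ⟨L, q, hq⟩ := exists_quasiIso_from_full_subcategory hP hA hZ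
    rw [← DerivedCategory.isIso_Q_map_iff_quasiIso] at hq
    obtain ⟨a, ha⟩ := G.map_surjective (q ≫ s)
    obtain ⟨b, hb⟩ := G.map_surjective (q ≫ t)
    have h₁ : IsIso (DerivedCategory.Q.map (G.map a)) := by
      rw [ha, Functor.map_comp]; infer_instance
    have h₂ : IsIso (DerivedCategory.Q.map a) := P.ι.isIso_Q_map_of_quasiIso_map a
      (by rwa [← DerivedCategory.isIso_Q_map_iff_quasiIso])
    refine ⟨eX.inv ≫ inv (DerivedCategory.Q.map a) ≫ DerivedCategory.Q.map b ≫ eY.hom, ?_⟩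
    have hs : DerivedCategory.Q.map t = DerivedCategory.Q.map s ≫
        e.inv.app _ ≫ Φ.map eX.hom ≫ f ≫ Φ.map eY.inv ≫ e.hom.app _ := by
      rw [fac, IsIso.hom_inv_id_assoc]
    have key : DerivedCategory.Q.map (G.map b) = DerivedCategory.Q.map (G.map a) ≫
        e.inv.app _ ≫ Φ.map eX.hom ≫ f ≫ Φ.map eY.inv ≫ e.hom.app _ := by
      rw [ha, hb, Functor.map_comp, Functor.map_comp, hs, Category.assoc]
    have hea := e.hom.naturality a
    have heb := e.hom.naturality b
    dsimp only [Functor.comp_map] at hea heb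
    have key' : Φ.map (DerivedCategory.Q.map b) = Φ.map (DerivedCategory.Q.map a) ≫
        Φ.map eX.hom ≫ f ≫ Φ.map eY.inv := by
      rw [← cancel_mono (e.hom.app _), heb, key, ← reassoc_of% hea]
      simp
    change Φ.map _ = f
    simp [key']
    exact Category.comp_id f

lemma derivedComparison_essSurj (hP : LiftsEpis P) (hA : HasFiniteGlobalDimension A) :
     (derivedComparison (A := A) P).EssSurj where
  mem_essImage X := by
    let K := DerivedCategory.Q.objPreimage X.obj
    let eK : DerivedCategory.Q.obj K ≅ X.obj := DerivedCategory.Q.objObjPreimageIso X.obj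
    have hK : HomologyIn P K := (homologyIn_iff_cohomologyIn_Q K).2
      ((cohomologyIn P).prop_of_iso eK.symm X.property)
    obtain ⟨L, q, hq⟩ := exists_quasiIso_from_full_subcategory hP hA hK
    rw [← DerivedCategory.isIso_Q_map_iff_quasiIso] at hq
    exact ⟨DerivedCategory.Q.obj L, ⟨(cohomologyIn P).isoMk
      (P.ι.mapDerivedCategoryFactors.app L ≪≫ asIso (DerivedCategory.Q.map q) ≪≫ eK)⟩⟩

lemma derivedComparison_isEquivalence (hP : LiftsEpis P) (hA : HasFiniteGlobalDimension A) :
     (derivedComparison (A := A) P).IsEquivalence := by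
  have := mapDerivedCategory_full.{w, w'} hP hA
  have : (P.ι.mapDerivedCategory : DerivedCategory P.FullSubcategory ⥤
    DerivedCategory A).Faithful := Functor.faithful_of_full_of_reflectsIsomorphisms _
  have := derivedComparison_essSurj.{w, w'} hP hA
  have : (derivedComparison (A := A) P).Full :=
    inferInstanceAs ((cohomologyIn P).lift P.ι.mapDerivedCategory _).Full
  have : (derivedComparison (A := A) P).Faithful :=
    inferInstanceAs ((cohomologyIn P).lift P.ι.mapDerivedCategory _).Faithful
  exact { }

variable (P) in
lemma derivedComparison_isTriangulated : (derivedComparison (A := A) P).IsTriangulated :=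
  inferInstanceAs ((cohomologyIn (A := A) P).lift P.ι.mapDerivedCategory
    (cohomologyIn_mapDerivedCategory P)).IsTriangulated

end SerreDerived

theorem theorem5p5 {A : Type u} [Category.{v} A] [Abelian A]
    [HasCountableCoproducts A] [CountableAB4 A]
    (hA : SerreDerived.HasFiniteGlobalDimension A)
    (U : ObjectProperty A) [U.Nonempty] [U.IsClosedUnderSubobjects]
    [U.IsClosedUnderQuotients] [U.IsClosedUnderExtensions]
    (hU : ∀ ⦃X Y : A⦄ (p : X ⟶ Y) [Epi p], U Y →
      ∃ V : Subobject X, U (V : A) ∧ Epi (V.arrow ≫ p))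
    [HasDerivedCategory.{w} A] [HasDerivedCategory.{w'} U.FullSubcategory] :
    (SerreDerived.derivedComparison (A := A) U).IsTriangulated ∧
      (SerreDerived.derivedComparison (A := A) U).IsEquivalence :=
  ⟨SerreDerived.derivedComparison_isTriangulated U,
    SerreDerived.derivedComparison_isEquivalence hU hA⟩
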